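/- Let $V=\{x_1,\dots,x_n\}$ be a finite set and let $\mathcal H=(V,\mathcal E)$ be a simple hypergraph, that is, every edge $E\in\mathcal E$ is a subset of $V$ with $|E|\ge 2$, and no edge is contained in a different edge. Let $k$ be a field, let $R=k[x_1,\dots,x_n]$ be the polynomial ring whose variables are the vertices, and let $$J=\Big(\prod_{x\in W}x \;:\; W\subseteq V,\ W\cap E\neq\emptyset \text{ for all } E\in\mathcal E\Big)\subseteq R$$ be the cover ideal of $\mathcal H$. A $d$-coloring of a hypergraph is a partition of its vertex set into $d$ disjoint (possibly empty) classes $C_1,\dots,C_d$ none of which contains an edge; the chromatic number $\chi$ is the least $d$ for which a $d$-coloring exists. A hypergraph is critically $d$-chromatic if $\chi=d$ and, for every vertex $x$, removing $x$ together with all edges containing $x$ yields a hypergraph with $\chi<d$. For $P\subseteq V$, let $\mathcal H_P$ be the induced subhypergraph with vertex set $P$ and edge set $\{E\in\mathcal E : E\subseteq P\}$; we also write $P$ for the ideal $(x : x\in P)\subseteq R$. Write $\operatorname{Ass}(M)$ for the set of associated primes of an $R$-module $M$, i.e. the prime ideals of the form $\operatorname{Ann}(m)$ with $m\in M$. Let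 $d\ge 1$ and $P\subseteq V$, and suppose that $\mathcal H_P$ is critically $(d+1)$-chromatic. Then (a) $P\in\operatorname{Ass}(R/J^d)$, and (b) $P\notin\operatorname{Ass}(R/J^e)$ for every integer $e$ with $1\le e<d$. -/

import Mathlib

namespace Hypergraph

variable {α : Type*}

/-- A hypergraph is simple if every edge has at least two vertices and no edge is contained in
a different edge. -/
structure IsSimple (H : Hypergraph α) : Prop where
  two_le_encard : ∀ e ∈ H.edgeSet, 2 ≤ e.encard
  not_subset : ∀ e ∈ H.edgeSet, ∀ f ∈ H.edgeSet, e ≠ f → ¬ e ⊆ f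

/-- The induced subhypergraph `H_P`: its vertex set is `P` and its edges are the edges of `H`
that are contained in `P`. It is used for `P ⊆ V(H)`. -/
def induced (H : Hypergraph α) (P : Set α) : Hypergraph α where
  vertexSet := P
  edgeSet := {e | e ∈ H.edgeSet ∧ e ⊆ P}
  subset_vertexSet_of_mem_edgeSet' := fun _ he => he.2

/-- The hypergraph `H \ {x}`: the vertex `x` and all edges containing `x` are removed. -/
def removeVertex (H : Hypergraph α) (x : α) : Hypergraph α where
  vertexSet := H.vertexSet \ {x}
  edgeSet := {e | e ∈ H.edgeSet ∧ x ∉ e}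
  subset_vertexSet_of_mem_edgeSet' := fun _ he _ hy =>
    ⟨H.subset_vertexSet_of_mem_edgeSet' he.1 hy, fun h => he.2 (Set.mem_singleton_iff.1 h ▸ hy)⟩

/-- `C` is a `d`-coloring of `H`: the color classes `C i` are disjoint, their union is the vertex
set, and no edge is contained in a color class. (Color classes may be empty; this does not affect
the least number of colors.) -/
structure IsColoring (H : Hypergraph α) {d : ℕ} (C : Fin d → Set α) : Prop where
  disjoint : ∀ i j, i ≠ j → Disjoint (C i) (C j)
  iUnion_eq : ⋃ i, C i = H.vertexSet
  not_subset : ∀ e ∈ H.edgeSet, ∀ i, ¬ e ⊆ C i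

/-- `H` has a `d`-coloring. -/
def IsColorable (H : Hypergraph α) (d : ℕ) : Prop :=
  ∃ C : Fin d → Set α, H.IsColoring C

/-- The chromatic number: the least `d` such that `H` has a `d`-coloring (`⊤` if there is
none). -/
noncomputable def chromaticNumber (H : Hypergraph α) : ℕ∞ :=
  ⨅ d ∈ {d : ℕ | H.IsColorable d}, (d : ℕ∞)

/-- `H` is critically `d`-chromatic: it has chromatic number `d`, and removing any vertex makes
the chromatic number smaller. -/
def IsCriticallyChromatic (H : Hypergraph α) (d : ℕ) : Prop :=
  H.chromaticNumber = d ∧ ∀ x ∈ H.vertexSet, (H.removeVertex x).chromaticNumber < d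

/-- A vertex cover: a set of vertices that meets every edge. -/
def IsVertexCover (H : Hypergraph α) (W : Finset α) : Prop :=
  (W : Set α) ⊆ H.vertexSet ∧ ∀ e ∈ H.edgeSet, ((W : Set α) ∩ e).Nonempty

/-- The cover ideal of `H` in the polynomial ring over `k` with the elements of `α` as variables:
the ideal generated by the monomials `∏ x ∈ W, x` for the vertex covers `W` of `H`. -/
noncomputable def coverIdeal (k : Type*) [CommRing k] (H : Hypergraph α) :
    Ideal (MvPolynomial α k) :=
  Ideal.span {m | ∃ W : Finset α, H.IsVertexCover W ∧ m = ∏ x ∈ W, MvPolynomial.X x}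

end Hypergraph

/-- The monomial ideal generated by the variables in `P`. -/
noncomputable def variableIdeal (k : Type*) [CommRing k] {α : Type*} (P : Set α) :
    Ideal (MvPolynomial α k) :=
  Ideal.span ((fun x : α => MvPolynomial.X x) '' P)

/-! The complement of a vertex cover contains no edge, so a product of `d` covers encodes `d`
candidate color classes, and a vertex of exponent below `d` lies in at least one of them. For (a),
`P` is the annihilator of the monomial with exponent `d - 1` on `P` and `d` elsewhere: `d`-colorings
of `H_P` minus a vertex put its multiples by the variables of `P` in `J^d`, and a multiplier
monomial free of `P` would yield a `d`-coloring of `H_P`. For (b), `P ∈ Ass(R/J^e)` makes `H_P`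
minus a vertex `e`-colorable, hence `H_P` is `(e + 1)`-colorable, impossible for `e < d`. -/

open scoped Classical Pointwise in
/-- Membership in a power of the cover ideal, read off the exponents: every exponent occurring in
`f` dominates a sum of indicators of `d` vertex covers. -/
theorem Hypergraph.mem_coverIdeal_pow {k : Type*} [CommRing k] {α : Type*} (H : Hypergraph α)
    (d : ℕ) (f : MvPolynomial α k) :
    f ∈ H.coverIdeal k ^ d ↔ ∀ m ∈ f.support, ∃ W : Fin d → Finset α,
      (∀ i, H.IsVertexCover (W i)) ∧ ∀ x, (∑ i, if x ∈ W i then 1 else 0) ≤ m x := by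
  have key : H.coverIdeal k ^ d = Ideal.span ((fun s => MvPolynomial.monomial s (1 : k)) ''
      {s | ∃ W : Fin d → Finset α, (∀ i, H.IsVertexCover (W i)) ∧
        s = ∑ i, ∑ x ∈ W i, Finsupp.single x 1}) := by
    rw [Hypergraph.coverIdeal, Ideal.span, Submodule.span_pow]
    congr 1
    ext p
    rw [Set.mem_pow]
    constructor
    · rintro ⟨g, rfl⟩
      choose W hW hg using fun i => (g i).2
      refine ⟨_, ⟨W, hW, rfl⟩, ?_⟩
      rw [List.prod_ofFn]
      simp only [MvPolynomial.monomial_sum_one]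
      exact Finset.prod_congr rfl fun i _ => (hg i).symm
    · rintro ⟨_, ⟨W, hW, rfl⟩, rfl⟩
      refine ⟨fun i => ⟨∏ x ∈ W i, MvPolynomial.X x, W i, hW i, rfl⟩, ?_⟩
      rw [List.prod_ofFn]
      simp only [MvPolynomial.monomial_sum_one]
      rfl
  rw [key, MvPolynomial.mem_ideal_span_monomial_image]
  refine forall₂_congr fun m _ => ?_
  have happ (W : Fin d → Finset α) (x : α) :
      (∑ i, ∑ y ∈ W i, Finsupp.single y 1 : α →₀ ℕ) x = ∑ i, if x ∈ W i then 1 else 0 := by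
    simp [Finsupp.finsetSum_apply, Finsupp.single_apply]
  constructor
  · rintro ⟨_, ⟨W, hW, rfl⟩, hle⟩
    exact ⟨W, hW, fun x => happ W x ▸ hle x⟩
  · rintro ⟨W, hW, hle⟩
    exact ⟨_, ⟨W, hW, rfl⟩, fun x => (happ W x).symm ▸ hle x⟩

/-- The ideal is the kernel of the substitution sending the variables in `P` to `0`, whose target is
a domain. -/
theorem variableIdeal_isPrime {k : Type*} [CommRing k] [IsDomain k] {α : Type*} (P : Set α) :
    (variableIdeal k P).IsPrime := by
  classical
  let φ : MvPolynomial α k →ₐ[k] MvPolynomial α k :=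
    MvPolynomial.aeval fun x => if x ∈ P then 0 else MvPolynomial.X x
  -- Modulo the ideal, `φ` changes nothing, so its kernel lies in the ideal.
  have hφ : (Ideal.Quotient.mkₐ k (variableIdeal k P)).comp φ =
      Ideal.Quotient.mkₐ k (variableIdeal k P) := by
    ext x
    by_cases hx : x ∈ P
    · have : (Ideal.Quotient.mk (variableIdeal k P)) (MvPolynomial.X x) = 0 :=
        Ideal.Quotient.eq_zero_iff_mem.2 (Ideal.subset_span ⟨x, hx, rfl⟩)
      simp [φ, hx, this]
    · simp [φ, hx]
  have : variableIdeal k P = RingHom.ker φ := by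
    apply le_antisymm
    · refine Ideal.span_le.2 ?_
      rintro _ ⟨x, hx, rfl⟩
      simp [RingHom.mem_ker, φ, hx]
    · intro f hf
      have h := DFunLike.congr_fun hφ f
      rw [AlgHom.comp_apply, RingHom.mem_ker.1 hf, map_zero] at h
      exact Ideal.Quotient.eq_zero_iff_mem.1 h.symm
  rw [this]
  exact RingHom.ker_isPrime _

theorem mem_associatedPrimes_quotient_iff {R : Type*} [CommRing R] [IsNoetherianRing R]
    (I Q : Ideal R) :
    Q ∈ associatedPrimes R (R ⧸ I) ↔ Q.IsPrime ∧ ∃ g : R, ∀ f, f ∈ Q ↔ f * g ∈ I := by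
  rw [AssociatedPrimes.mem_iff, isAssociatedPrime_iff]
  refine and_congr_right fun _ => ?_
  rw [Ideal.Quotient.mk_surjective.exists]
  refine exists_congr fun g => ?_
  rw [SetLike.ext_iff]
  refine forall_congr' fun f => ?_
  rw [Submodule.mem_colon_singleton, Submodule.mem_bot,
    ← Ideal.Quotient.eq_zero_iff_mem (I := I), map_mul]
  rfl

/-! ### Colorings and complements of vertex covers -/

namespace Hypergraph

variable {α : Type*} {H : Hypergraph α}

/-- Sets without edges that cover the vertex set can be refined to a coloring. -/
theorem isColorable_of_cover {d : ℕ} (C : Fin d → Set α) (hC : ∀ x ∈ H.vertexSet, ∃ i, x ∈ C i)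
    (hE : ∀ e ∈ H.edgeSet, ∀ i, ¬ e ⊆ C i) : H.IsColorable d := by
  choose c hc using hC
  refine ⟨fun i => {x | ∃ hx : x ∈ H.vertexSet, c x hx = i}, ⟨fun i j hij => ?_, ?_, ?_⟩⟩
  · rw [Set.disjoint_left]
    rintro x ⟨hx, rfl⟩ ⟨_, h⟩
    exact hij h
  · ext x
    simp only [Set.mem_iUnion, Set.mem_ofPred_eq]
    exact ⟨fun ⟨_, hx, _⟩ => hx, fun hx => ⟨_, hx, rfl⟩⟩
  · intro e he i hei
    refine hE e he i fun x hx => ?_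
    obtain ⟨hxV, rfl⟩ := hei hx
    exact hc x hxV

theorem IsColorable.succ {d : ℕ} (h : H.IsColorable d) (hne : ∀ e ∈ H.edgeSet, e.Nonempty) :
    H.IsColorable (d + 1) := by
  obtain ⟨C, hC⟩ := h
  -- The added class is empty; it contains no edge because edges are nonempty.
  refine isColorable_of_cover (Fin.cons ∅ C : Fin (d + 1) → Set α) (fun x hx => ?_) fun e he i => ?_
  · rw [← hC.iUnion_eq] at hx
    obtain ⟨i, hi⟩ := Set.mem_iUnion.1 hx
    exact ⟨i.succ, by simpa using hi⟩
  · refine Fin.cases ?_ (fun i => ?_) i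
    · simpa [Set.subset_empty_iff] using (hne e he).ne_empty
    · simpa using hC.not_subset e he i

theorem IsColorable.mono {d d' : ℕ} (h : H.IsColorable d) (hne : ∀ e ∈ H.edgeSet, e.Nonempty)
    (hd : d ≤ d') : H.IsColorable d' := by
  induction hd with
  | refl => exact h
  | step _ ih => exact ih.succ hne

theorem IsColorable.chromaticNumber_le {d : ℕ} (h : H.IsColorable d) : H.chromaticNumber ≤ d :=
  iInf₂_le d h

theorem isColorable_of_chromaticNumber_lt {d : ℕ} (hne : ∀ e ∈ H.edgeSet, e.Nonempty)
    (h : H.chromaticNumber < (d + 1 : ℕ)) : H.IsColorable d := by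
  simp only [chromaticNumber, iInf_lt_iff] at h
  obtain ⟨d', hd', hlt⟩ := h
  exact IsColorable.mono hd' hne (Nat.lt_succ_iff.1 (by exact_mod_cast hlt))

/-- Reinserting a vertex costs at most one color. -/
theorem IsColorable.of_removeVertex {d : ℕ} {x : α} (h : (H.removeVertex x).IsColorable d)
    (h2 : ∀ e ∈ H.edgeSet, 2 ≤ e.encard) : H.IsColorable (d + 1) := by
  obtain ⟨C, hC⟩ := h
  refine isColorable_of_cover (Fin.cons {x} C : Fin (d + 1) → Set α) (fun y hy => ?_)
    fun e he i => ?_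
  · by_cases hyx : y = x
    · exact ⟨0, by simpa using hyx⟩
    · have hy' : y ∈ (H.removeVertex x).vertexSet := ⟨hy, hyx⟩
      rw [← hC.iUnion_eq] at hy'
      obtain ⟨i, hi⟩ := Set.mem_iUnion.1 hy'
      exact ⟨i.succ, by simpa using hi⟩
  · refine Fin.cases ?_ (fun i => ?_) i
    · intro hsub
      have h1 := (h2 e he).trans (Set.encard_le_encard hsub)
      simp at h1
    · intro hsub
      rw [Fin.cons_succ] at hsub
      have hCi : C i ⊆ (H.removeVertex x).vertexSet := hC.iUnion_eq ▸ Set.subset_iUnion C i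
      exact hC.not_subset e ⟨he, fun hx => (hCi (hsub hx)).2 rfl⟩ i hsub

theorem IsVertexCover.not_subset_compl {W : Finset α} (hW : H.IsVertexCover W) {e : Set α}
    (he : e ∈ H.edgeSet) : ¬ e ⊆ (W : Set α)ᶜ := by
  obtain ⟨y, hyW, hye⟩ := hW.2 e he
  exact fun h => h hye hyW

end Hypergraph

open Classical in
theorem sum_ite_mem_le {α : Type*} {d : ℕ} (W : Fin d → Finset α) (x : α) :
    (∑ i, if x ∈ W i then 1 else 0) ≤ d := by
  simpa using Finset.card_le_univ (Finset.univ.filter fun i => x ∈ W i)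

open Classical in
theorem exists_notMem_of_sum_lt {α : Type*} {d : ℕ} {W : Fin d → Finset α} {x : α}
    (h : (∑ i, if x ∈ W i then 1 else 0) < d) : ∃ i, x ∉ W i := by
  by_contra! hall
  simp [hall] at h

/-! ### Colorability and associated primes -/

namespace Hypergraph

variable {k : Type*} [Field k] {V : Type*} [Finite V] {H : Hypergraph V} {P : Set V}

theorem variableIdeal_mem_associatedPrimes (hV : H.vertexSet = Set.univ) {d : ℕ} (hd : 1 ≤ d)
    (hnot : ¬ (H.induced P).IsColorable d)
    (hcol : ∀ x ∈ P, ((H.induced P).removeVertex x).IsColorable d) :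
    variableIdeal k P ∈
      associatedPrimes (MvPolynomial V k) (MvPolynomial V k ⧸ H.coverIdeal k ^ d) := by
  classical
  have := Fintype.ofFinite V
  rw [mem_associatedPrimes_quotient_iff]
  refine ⟨variableIdeal_isPrime P, ?_⟩
  let a : V →₀ ℕ := Finsupp.equivFunOnFinite.symm fun x => if x ∈ P then d - 1 else d
  have ha (x : V) : a x = if x ∈ P then d - 1 else d := rfl
  refine ⟨MvPolynomial.monomial a 1, fun f => ⟨fun hf => ?_, fun hf => ?_⟩⟩
  · suffices h : variableIdeal k P ≤ (H.coverIdeal k ^ d).colon {MvPolynomial.monomial a 1} by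
      simpa [Submodule.mem_colon_singleton] using h hf
    refine Ideal.span_le.2 ?_
    rintro _ ⟨x, hx, rfl⟩
    rw [SetLike.mem_coe, Submodule.mem_colon_singleton, smul_eq_mul]
    change MvPolynomial.monomial (Finsupp.single x 1) 1 * _ ∈ _
    rw [MvPolynomial.monomial_mul, mem_coverIdeal_pow]
    intro m hm
    obtain rfl := Finset.mem_singleton.1 (MvPolynomial.support_monomial_subset hm)
    obtain ⟨C, hC⟩ := hcol x hx
    have hCi (i : Fin d) : C i ⊆ ((H.induced P).removeVertex x).vertexSet :=
      hC.iUnion_eq ▸ Set.subset_iUnion C i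
    -- The complements of the color classes, taken in all of `V`, are covers of `H`. All `d` of them
    -- contain `x` and every vertex outside `P`; each other vertex of `P` is missed by one.
    refine ⟨fun i => Finset.univ.filter (· ∉ C i), fun i => ⟨by simp [hV], fun e he => ?_⟩,
      fun y => ?_⟩
    · by_contra hempty
      have hsub : e ⊆ C i := fun y hy => by
        by_contra hyC
        exact hempty ⟨y, by simpa using hyC, hy⟩
      exact hC.not_subset e ⟨⟨he, fun y hy => (hCi i (hsub hy)).1⟩,
        fun hxe => (hCi i (hsub hxe)).2 rfl⟩ i hsub
    · have hle : (∑ i, if y ∈ Finset.univ.filter (· ∉ C i) then 1 else 0) ≤ d :=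
        sum_ite_mem_le _ y
      refine le_trans ?_ (le_of_eq (Finsupp.add_apply _ _ _).symm)
      rw [ha, Finsupp.single_apply]
      by_cases hyP : y ∈ P
      · by_cases hyx : x = y
        · simp only [hyP, hyx, if_true]
          omega
        · have hy : y ∈ ((H.induced P).removeVertex x).vertexSet := ⟨hyP, fun h => hyx h.symm⟩
          rw [← hC.iUnion_eq] at hy
          obtain ⟨i, hi⟩ := Set.mem_iUnion.1 hy
          have hlt : (∑ i, if y ∈ Finset.univ.filter (· ∉ C i) then 1 else 0) <
              ∑ _i : Fin d, 1 :=
            Finset.sum_lt_sum (fun j _ => by split_ifs <;> simp) ⟨i, Finset.mem_univ _, by simp [hi]⟩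
          simp only [Finset.sum_const, Finset.card_univ, Fintype.card_fin, smul_eq_mul,
            mul_one] at hlt
          simp only [hyP, hyx, if_true, if_false]
          omega
      · simp only [hyP, if_false]
        omega
  · rw [variableIdeal, MvPolynomial.mem_ideal_span_X_image]
    intro m hm
    -- If `m` involves no variable of `P`, then `m + a` is still `d - 1` on `P`, so each vertex of
    -- `P` is missed by some cover.
    by_contra! hzero
    rw [mem_coverIdeal_pow] at hf
    have hmem : m + a ∈ (f * MvPolynomial.monomial a 1).support := by
      rw [MvPolynomial.mem_support_iff, MvPolynomial.coeff_mul_monomial, mul_one]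
      exact MvPolynomial.mem_support_iff.1 hm
    obtain ⟨W, hW, hle⟩ := hf _ hmem
    refine hnot (isColorable_of_cover (fun i => (W i : Set V)ᶜ) (fun x hx => ?_)
      fun e he i => (hW i).not_subset_compl he.1)
    have hx' : x ∈ P := hx
    have h := hle x
    rw [Finsupp.add_apply, ha, hzero x hx', if_pos hx'] at h
    exact exists_notMem_of_sum_lt (by omega)

theorem removeVertex_isColorable_of_mem_associatedPrimes {e : ℕ}
    (h : variableIdeal k P ∈
      associatedPrimes (MvPolynomial V k) (MvPolynomial V k ⧸ H.coverIdeal k ^ e)) {x : V}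
    (hx : x ∈ P) : ((H.induced P).removeVertex x).IsColorable e := by
  classical
  rw [mem_associatedPrimes_quotient_iff] at h
  obtain ⟨hprime, g, hg⟩ := h
  have hgJ : g ∉ H.coverIdeal k ^ e := fun hgJ =>
    (Ideal.ne_top_iff_one _).1 hprime.ne_top ((hg 1).2 (by rwa [one_mul]))
  rw [mem_coverIdeal_pow] at hgJ
  push Not at hgJ
  obtain ⟨m, hm, hno⟩ := hgJ
  -- Multiplying by a variable of `P` pushes `g` into the power, so raising `m` by one at `z`
  -- suffices.
  have hex (z : V) (hz : z ∈ P) : ∃ W : Fin e → Finset V, (∀ i, H.IsVertexCover (W i)) ∧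
      ∀ y, (∑ i, if y ∈ W i then 1 else 0) ≤ m y + if z = y then 1 else 0 := by
    have hzg := (hg (MvPolynomial.X z)).1 (Ideal.subset_span ⟨z, hz, rfl⟩)
    rw [mul_comm, mem_coverIdeal_pow] at hzg
    have hmem : m + Finsupp.single z 1 ∈ (g * MvPolynomial.X z).support := by
      rw [MvPolynomial.mem_support_iff, MvPolynomial.coeff_mul_X]
      exact MvPolynomial.mem_support_iff.1 hm
    obtain ⟨W, hW, hle⟩ := hzg _ hmem
    exact ⟨W, hW, fun y => by simpa [Finsupp.single_apply] using hle y⟩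
  -- Any `e` covers contain `z` at most `e` times. If `m z ≥ e`, the extra factor at `z` was not
  -- needed and `m` itself would dominate `e` covers, contrary to `hno`.
  have hlt (z : V) (hz : z ∈ P) : m z < e := by
    by_contra! hge
    obtain ⟨W, hW, hle⟩ := hex z hz
    obtain ⟨y, hy⟩ := hno W hW
    by_cases hzy : z = y
    · subst hzy
      have hle' : (∑ i, if z ∈ W i then 1 else 0) ≤ e := sum_ite_mem_le W z
      omega
    · have := hle y
      rw [if_neg hzy] at this
      omega
  obtain ⟨W, hW, hle⟩ := hex x hx
  refine isColorable_of_cover (fun i => (W i : Set V)ᶜ) (fun y hy => ?_)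
    fun E hE i => (hW i).not_subset_compl hE.1.1
  have h1 := hle y
  have h2 := hlt y hy.1
  rw [if_neg fun h => hy.2 h.symm] at h1
  exact exists_notMem_of_sum_lt (by omega)

end Hypergraph

theorem mainTheorem6 {k : Type*} [Field k] {V : Type*} [Finite V]
    (H : Hypergraph V) (hV : H.vertexSet = Set.univ) (hH : H.IsSimple)
    (P : Set V) (d : ℕ) (hd : 1 ≤ d)
    (hP : (H.induced P).IsCriticallyChromatic (d + 1)) :
    variableIdeal k P ∈
        associatedPrimes (MvPolynomial V k) (MvPolynomial V k ⧸ H.coverIdeal k ^ d) ∧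
      ∀ e : ℕ, 1 ≤ e → e < d →
        variableIdeal k P ∉
          associatedPrimes (MvPolynomial V k) (MvPolynomial V k ⧸ H.coverIdeal k ^ e) := by
  obtain ⟨hchi, hcrit⟩ := hP
  have h2 : ∀ e ∈ (H.induced P).edgeSet, 2 ≤ e.encard := fun e he => hH.two_le_encard e he.1
  have hne : ∀ e ∈ (H.induced P).edgeSet, e.Nonempty := fun e he => by
    rw [Set.nonempty_iff_ne_empty]
    rintro rfl
    simpa using h2 _ he
  have hnot {c : ℕ} (hc : c ≤ d) : ¬ (H.induced P).IsColorable c := fun h => by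
    have hle := h.chromaticNumber_le
    rw [hchi] at hle
    have hle' : d + 1 ≤ c := by exact_mod_cast hle
    omega
  refine ⟨Hypergraph.variableIdeal_mem_associatedPrimes hV hd (hnot le_rfl) fun x hx =>
    Hypergraph.isColorable_of_chromaticNumber_lt (fun e he => hne e he.1)
      (by exact_mod_cast hcrit x hx), fun e _ hed hass => ?_⟩
  -- For empty `P`, zero colors would suffice.
  obtain ⟨x, hx⟩ : P.Nonempty := by
    by_contra hempty
    refine hnot (Nat.zero_le d) (Hypergraph.isColorable_of_cover (fun _ => ∅)
      (fun x hx => (hempty ⟨x, hx⟩).elim) fun _ _ i => i.elim0)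
  exact hnot hed <|
    (Hypergraph.removeVertex_isColorable_of_mem_associatedPrimes hass hx).of_removeVertex h2
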